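/- Let $p$ be a prime and let $G$ be a finite $p$-group with $|G:G'| = p^2$ and $|G| \ge p^6$. Write $\gamma_1(G) = G$ and $\gamma_{i+1}(G) = [\gamma_i(G), G]$ for the terms of the lower central series, so that $G' = \gamma_2(G)$. Then the conditions $|\gamma_3(G):\gamma_4(G)| > p$ and $|G:\gamma_4(G)| = p^5$ are equivalent, and if they hold, then $G$ has an irreducible complex character of degree exactly $p^2$. -/

import Mathlib

/-- `χ : G → ℂ` is an irreducible (complex) character of `G`: the trace function of an irreducible
representation of `G` on a finite-dimensional complex vector space, which after a choice of basis
is `ℂⁿ` for some `n`. The degree of `χ` is `χ 1`. -/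
def IsIrreducibleCharacter {G : Type*} [Group G] (χ : G → ℂ) : Prop :=
  ∃ (n : ℕ) (ρ : Representation ℂ G (Fin n → ℂ)), ρ.IsIrreducible ∧ ρ.character = χ

/-- The lower central series in the usual numbering, `γ₁(G) = G` and `γᵢ₊₁(G) = [γᵢ(G), G]` for
`i ≥ 1` (Mathlib's series starts with index `0`). -/
def lowerCentralTerm (G : Type*) [Group G] (i : ℕ) : Subgroup G :=
  (⊤ : Subgroup G).lowerCentralSeries (i - 1)

/-! Mathlib's `lowerCentralSeries` at `n` is `γₙ₊₁`. Since `|γ₂ : γ₃| = p`, any `c ∈ γ₂ \ γ₃`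
generates `γ₂` modulo `γ₃`, so `|γ₃ : γ₄|` is the index of the centralizer of `c` modulo `γ₄`. This
contains `γ₂`, because `[γ₂, γ₂] ≤ γ₅`; hence `|γ₃ : γ₄|` divides `p²`, and the equivalence follows
by counting.

If the index is `p²`, nothing outside `γ₂` centralizes `c` modulo `γ₄`, and `|G| ≥ p⁶` gives `γ₅ <
γ₄`. In `exists_linearCharacterStabilizer_le`, a linear character `ν` of `γ₂`, trivial on `γ₅` but
not on `γ₄`, is twisted if necessary by some `θ` trivial on `γ₄`, so that its stabilizer becomes
`γ₂`. Coinducing to `G` (`coind_isIrreducible`) gives degree `|G : γ₂| = p²`. -/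

open scoped commutatorElement

/-! ### Commutators and centralizers modulo a normal subgroup -/

section CentralizerMod

variable {G : Type*} [Group G]

/-- The elements of `G` that commute with every element of `S` modulo the normal subgroup `N`. -/
def centralizerMod (N : Subgroup G) [N.Normal] (S : Set G) : Subgroup G :=
  (Subgroup.centralizer (QuotientGroup.mk' N '' S)).comap (QuotientGroup.mk' N)

theorem mem_centralizerMod {N : Subgroup G} [N.Normal] {S : Set G} {g : G} :
    g ∈ centralizerMod N S ↔ ∀ s ∈ S, ⁅s, g⁆ ∈ N := by
  simp only [centralizerMod, Subgroup.mem_comap, Subgroup.mem_centralizer_iff_commutator_eq_one,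
    Set.forall_mem_image]
  refine forall₂_congr fun s _ => ?_
  rw [← map_commutatorElement, QuotientGroup.mk'_apply, QuotientGroup.eq_one_iff]

theorem commutatorElement_mem_comm {N : Subgroup G} {g h : G} : ⁅g, h⁆ ∈ N ↔ ⁅h, g⁆ ∈ N := by
  rw [← commutatorElement_inv, inv_mem_iff]

theorem mem_centralizerMod_singleton {N : Subgroup G} [N.Normal] {c g : G} :
    g ∈ centralizerMod N {c} ↔ ⁅c, g⁆ ∈ N := by
  simp [mem_centralizerMod]

/-- For `S = Set.univ` the centralizer is the preimage of the centre of `G ⧸ N`. -/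
theorem mem_centralizerMod_univ {N : Subgroup G} [N.Normal] {g : G} :
    g ∈ centralizerMod N Set.univ ↔ ∀ h, ⁅g, h⁆ ∈ N := by
  simp only [mem_centralizerMod, Set.mem_univ, true_imp_iff]
  exact forall_congr' fun h => commutatorElement_mem_comm

instance centralizerMod_univ_normal (N : Subgroup G) [N.Normal] :
    (centralizerMod N Set.univ).Normal where
  conj_mem n hn g := by
    rw [mem_centralizerMod_univ] at hn ⊢
    intro h
    have := ‹N.Normal›.conj_mem _ (hn (g⁻¹ * h * g)) g
    rw [conjugate_commutatorElement] at this
    simpa [mul_assoc] using this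

/-- A subgroup between `N` and `H` is normal if `H` is central modulo `N`. -/
theorem normal_of_le_of_commutator_le {N H J : Subgroup G} (hHN : ⁅H, (⊤ : Subgroup G)⁆ ≤ N)
    (hNJ : N ≤ J) (hJH : J ≤ H) : J.Normal :=
  Subgroup.commutator_top_right_le_iff.mp
    ((Subgroup.commutator_mono hJH le_rfl).trans (hHN.trans hNJ))

/-- The three subgroups lemma modulo a normal subgroup. -/
theorem commutator_commutator_le_of_rotate {N H₁ H₂ H₃ : Subgroup G} [N.Normal]
    (h1 : ⁅⁅H₂, H₃⁆, H₁⁆ ≤ N) (h2 : ⁅⁅H₃, H₁⁆, H₂⁆ ≤ N) : ⁅⁅H₁, H₂⁆, H₃⁆ ≤ N := by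
  rw [← QuotientGroup.ker_mk' N, ← Subgroup.map_eq_bot_iff, Subgroup.map_commutator,
    Subgroup.map_commutator] at h1 h2 ⊢
  exact Subgroup.commutator_commutator_eq_bot_of_rotate h1 h2

/-- The homomorphism `g ↦ ⁅c, g⁆` modulo `N`, when all `⁅c, g⁆` are central modulo `N`. -/
def commutatorHomMod (N : Subgroup G) [N.Normal] (c : G) (hc : ∀ g h : G, ⁅⁅c, g⁆, h⁆ ∈ N) :
    G →* G ⧸ N where
  toFun g := QuotientGroup.mk' N ⁅c, g⁆
  map_one' := by simp
  map_mul' g h := by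
    have : QuotientGroup.mk' N ⁅⁅c, h⁆, g⁆ = 1 :=
      (QuotientGroup.eq_one_iff (N := N) _).mpr (hc h g)
    rw [map_commutatorElement, commutatorElement_eq_one_iff_mul_comm] at this
    rw [commutatorElement_mul_right_eq_mul_conj]
    simp only [map_mul, map_inv, mul_assoc] at this ⊢
    rw [← mul_assoc (QuotientGroup.mk' N g), ← this]
    simp

theorem ker_commutatorHomMod (N : Subgroup G) [N.Normal] (c : G)
    (hc : ∀ g h : G, ⁅⁅c, g⁆, h⁆ ∈ N) :
    (commutatorHomMod N c hc).ker = centralizerMod N {c} := by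
  ext g
  rw [mem_centralizerMod_singleton, MonoidHom.mem_ker]
  exact QuotientGroup.eq_one_iff _

/-- If `H` is central modulo `N` and generated modulo `N` by the commutators `⁅c, g⁆`, then
`|H : N|` is the index of the centralizer of `c` modulo `N`. -/
theorem relIndex_eq_index_centralizerMod {N H : Subgroup G} [N.Normal] {c : G} (hNH : N ≤ H)
    (hHN : ⁅H, (⊤ : Subgroup G)⁆ ≤ N) (hc : ∀ g, ⁅c, g⁆ ∈ H)
    (hgen : ∀ J : Subgroup G, J.Normal → N ≤ J → (∀ g, ⁅c, g⁆ ∈ J) → H ≤ J) :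
    N.relIndex H = (centralizerMod N {c}).index := by
  have hcN : ∀ g h, ⁅⁅c, g⁆, h⁆ ∈ N := fun g h =>
    hHN (Subgroup.commutator_mem_commutator (hc g) (Subgroup.mem_top h))
  have hrange : (commutatorHomMod N c hcN).range = H.map (QuotientGroup.mk' N) := by
    apply le_antisymm
    · rintro _ ⟨g, rfl⟩
      exact ⟨_, hc g, rfl⟩
    · have hNJ : N ≤ (commutatorHomMod N c hcN).range.comap (QuotientGroup.mk' N) := by
        intro n hn
        have : QuotientGroup.mk' N n = 1 := (QuotientGroup.eq_one_iff (N := N) n).mpr hn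
        rw [Subgroup.mem_comap, this]
        exact one_mem _
      rw [Subgroup.map_le_iff_le_comap]
      refine hgen _ (normal_of_le_of_commutator_le hHN hNJ ?_) hNJ fun g => ⟨g, rfl⟩
      rintro x ⟨g, hg⟩
      have h1 : ⁅c, g⁆⁻¹ * x ∈ N := QuotientGroup.eq.mp hg
      rw [← mul_inv_cancel_left ⁅c, g⁆ x]
      exact mul_mem (hc g) (hNH h1)
  rw [← ker_commutatorHomMod N c hcN, Subgroup.index_ker, hrange, ← Subgroup.relIndex_ker,
    QuotientGroup.ker_mk']

/-- A subgroup of prime index in `L` together with one further element of `L` generates `L`. -/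
theorem le_of_relIndex_prime {H K L : Subgroup G} (hp : (H.relIndex L).Prime) (hHL : H ≤ L)
    (hHK : H ≤ K) {c : G} (hcL : c ∈ L) (hcK : c ∈ K) (hcH : c ∉ H) : L ≤ K := by
  have hmul := Subgroup.relIndex_mul_relIndex H (K ⊓ L) L (le_inf hHK hHL) inf_le_right
  rcases hp.eq_one_or_self_of_dvd _ ⟨_, hmul.symm⟩ with h | h
  · exact absurd (Subgroup.relIndex_eq_one.mp h ⟨hcK, hcL⟩) hcH
  · rw [h] at hmul
    have : (K ⊓ L).relIndex L = 1 := by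
      have := hp.pos
      nlinarith
    exact (Subgroup.relIndex_eq_one.mp this).trans inf_le_left

theorem eq_top_of_index_prime {H K : Subgroup G} (hp : H.index.Prime) (hHK : H ≤ K) {c : G}
    (hcK : c ∈ K) (hcH : c ∉ H) : K = ⊤ := by
  rw [← Subgroup.relIndex_top_right] at hp
  exact top_le_iff.mp (le_of_relIndex_prime hp le_top hHK (Subgroup.mem_top c) hcK hcH)

/-- A proper overgroup of a subgroup of index `p ^ 2` has index `1` or `p`. -/
theorem eq_top_or_index_eq_of_index_sq {p : ℕ} (hp : p.Prime) {H K : Subgroup G}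
    (hH : H.index = p ^ 2) (hHK : H ≤ K) {c : G} (hcK : c ∈ K) (hcH : c ∉ H) :
    K = ⊤ ∨ K.index = p := by
  have hmul := Subgroup.relIndex_mul_index hHK
  obtain ⟨k, hk, hkK⟩ := (Nat.dvd_prime_pow hp).mp (hH ▸ (⟨_, by rw [← hmul, mul_comm]⟩ :
    K.index ∣ H.index))
  interval_cases k
  · left; simpa using hkK
  · right; simpa using hkK
  · rw [hH, hkK] at hmul
    have : H.relIndex K = 1 := by
      have : 0 < p ^ 2 := pow_pos hp.pos 2
      nlinarith
    exact absurd (Subgroup.relIndex_eq_one.mp this hcK) hcH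

end CentralizerMod

/-! ### Factors of the lower central series -/

section LowerCentralSeries

variable {G : Type*} [Group G]

local notation "Γ" => Subgroup.lowerCentralSeries (⊤ : Subgroup G)

theorem commutator_mem_lowerCentralSeries_succ {n : ℕ} {a : G} (ha : a ∈ Γ n) (g : G) :
    ⁅a, g⁆ ∈ Γ (n + 1) :=
  Subgroup.commutator_mem_commutator ha (Subgroup.mem_top g)

theorem lowerCentralSeries_succ_le (n : ℕ) : Γ (n + 1) ≤ Γ n :=
  Subgroup.lowerCentralSeries_antitone _ n.le_succ

theorem lowerCentralSeries_le_centralizerMod {n : ℕ} {J : Subgroup G} [J.Normal]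
    (hJ : Γ (n + 1) ≤ J) : Γ n ≤ centralizerMod J Set.univ := fun _ ha =>
  mem_centralizerMod_univ.mpr fun g => hJ (commutator_mem_lowerCentralSeries_succ ha g)

/-- Once a term repeats, the series is constant, and nilpotency makes it trivial. -/
theorem lowerCentralSeries_succ_lt [Group.IsNilpotent G] {n : ℕ} (hn : Γ n ≠ ⊥) :
    ¬ Γ n ≤ Γ (n + 1) := by
  intro hle
  obtain ⟨k, hk⟩ := Subgroup.nilpotent_iff_lowerCentralSeries.mp ‹Group.IsNilpotent G›
  have heq : ∀ m, Γ n ≤ Γ (n + m) := by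
    intro m
    induction m with
    | zero => exact le_rfl
    | succ m ih => exact hle.trans (Subgroup.commutator_mono ih le_rfl)
  have h2 : Γ (n + k) ≤ Γ k := Subgroup.lowerCentralSeries_antitone _ (Nat.le_add_left k n)
  exact hn (le_bot_iff.mp (((heq k).trans h2).trans hk.le))

/-- If `|G : G'| = p ^ 2` and `G' ≠ 1`, then `|γ₂ : γ₃| = p`. -/
theorem relIndex_lowerCentralSeries_one [Group.IsNilpotent G] {p : ℕ} (hp : p.Prime)
    (hindex : (Γ 1).index = p ^ 2) (hne : Γ 1 ≠ ⊥) : (Γ 2).relIndex (Γ 1) = p := by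
  have hlt : ¬ Γ 1 ≤ Γ 2 := lowerCentralSeries_succ_lt hne
  obtain ⟨x, hx⟩ : ∃ x, x ∉ Γ 1 := by
    by_contra! h
    rw [Subgroup.index_eq_one.mpr (Subgroup.eq_top_iff' _ |>.mpr h)] at hindex
    exact absurd hindex.symm (Nat.one_lt_pow two_ne_zero hp.one_lt).ne'
  have hgen : ∀ J : Subgroup G, J.Normal → Γ 2 ≤ J → (∀ g, ⁅x, g⁆ ∈ J) → Γ 1 ≤ J := by
    intro J hJ h2 hxJ
    suffices h : centralizerMod J Set.univ = ⊤ by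
      refine Subgroup.commutator_le.mpr fun g _ h' _ => ?_
      exact mem_centralizerMod_univ.mp (h ▸ Subgroup.mem_top g) h'
    have hle := lowerCentralSeries_le_centralizerMod h2
    have hxZ : x ∈ centralizerMod J Set.univ := mem_centralizerMod_univ.mpr hxJ
    rcases eq_top_or_index_eq_of_index_sq hp hindex hle hxZ hx with h | h
    · exact h
    -- The centre of a group never has prime index: the centralizer of a noncentral `y` would
    -- contain the centre and `y`, hence be everything.
    · by_contra hne'
      obtain ⟨y, hy⟩ : ∃ y, y ∉ centralizerMod J Set.univ := by
        by_contra! h'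
        exact hne' ((Subgroup.eq_top_iff' _).mpr h')
      have htop : centralizerMod J {y} = ⊤ := by
        refine eq_top_of_index_prime (h ▸ hp) ?_
          (mem_centralizerMod_singleton.mpr (by simp)) hy
        intro z hz
        rw [mem_centralizerMod_singleton, commutatorElement_mem_comm]
        exact mem_centralizerMod_univ.mp hz y
      refine hy (mem_centralizerMod_univ.mpr fun g => ?_)
      exact mem_centralizerMod_singleton.mp (htop ▸ Subgroup.mem_top g)
  have hrel := relIndex_eq_index_centralizerMod (lowerCentralSeries_succ_le 1) le_rfl
    (fun g => commutator_mem_lowerCentralSeries_succ (n := 0) (Subgroup.mem_top x) g) hgen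
  have hle : Γ 1 ≤ centralizerMod (Γ 2) {x} := fun a ha =>
    mem_centralizerMod_singleton.mpr
      (commutatorElement_mem_comm.mp (commutator_mem_lowerCentralSeries_succ ha x))
  rcases eq_top_or_index_eq_of_index_sq hp hindex hle
    (mem_centralizerMod_singleton.mpr (by simp)) hx with h | h
  · rw [h, Subgroup.index_top, Subgroup.relIndex_eq_one] at hrel
    exact absurd hrel hlt
  · rw [hrel, h]

/-- If `|γ₂ : γ₃|` is prime, then `|γ₃ : γ₄|` is the index of the centralizer modulo `γ₄` of any
element of `γ₂ \ γ₃`. -/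
theorem relIndex_lowerCentralSeries_two {c : G} (hp : ((Γ 2).relIndex (Γ 1)).Prime)
    (hc : c ∈ Γ 1) (hc' : c ∉ Γ 2) :
    (Γ 3).relIndex (Γ 2) = (centralizerMod (Γ 3) {c}).index := by
  refine relIndex_eq_index_centralizerMod (lowerCentralSeries_succ_le 2) le_rfl
    (fun g => commutator_mem_lowerCentralSeries_succ hc g) fun J hJ h3 hcJ => ?_
  have hle := le_of_relIndex_prime hp (lowerCentralSeries_succ_le 1)
    (lowerCentralSeries_le_centralizerMod h3) hc (mem_centralizerMod_univ.mpr hcJ) hc'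
  exact Subgroup.commutator_le.mpr fun a ha g _ => mem_centralizerMod_univ.mp (hle ha) g

/-- `[γ₂, γ₃] ≤ γ₅`. -/
theorem commutator_lowerCentralSeries_one_two_le : ⁅Γ 1, Γ 2⁆ ≤ Γ 4 := by
  -- Here `γ₂ = [G, G]`, and both rotated commutators are `[[γ₃, G], G] = γ₅`.
  apply commutator_commutator_le_of_rotate
  · rw [Subgroup.commutator_comm ⊤ (Γ 2)]; exact le_rfl
  · exact le_rfl

/-- If `|γ₂ : γ₃|` is prime, then `γ₂` is abelian modulo `γ₅`. -/
theorem commutator_lowerCentralSeries_one_one_le (hp : ((Γ 2).relIndex (Γ 1)).Prime) :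
    ⁅Γ 1, Γ 1⁆ ≤ Γ 4 := by
  obtain ⟨c, hc, hc'⟩ : ∃ c ∈ Γ 1, c ∉ Γ 2 := by
    by_contra! h
    exact hp.ne_one (Subgroup.relIndex_eq_one.mpr h)
  have h12 := Subgroup.commutator_le.mp (commutator_lowerCentralSeries_one_two_le (G := G))
  -- `γ₂` is generated by `γ₃` and `c`. Both centralize `c` modulo `γ₅`, so `γ₂` does; then both
  -- centralize all of `γ₂`.
  have hcent : Γ 1 ≤ centralizerMod (Γ 4) {c} :=
    le_of_relIndex_prime hp (lowerCentralSeries_succ_le 1)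
      (fun a ha => mem_centralizerMod_singleton.mpr (h12 c hc a ha)) hc
      (mem_centralizerMod_singleton.mpr (by simp)) hc'
  have hall : Γ 1 ≤ centralizerMod (Γ 4) (Γ 1 : Set G) :=
    le_of_relIndex_prime hp (lowerCentralSeries_succ_le 1)
      (fun a ha => mem_centralizerMod.mpr fun s hs => h12 s hs a ha) hc
      (mem_centralizerMod.mpr fun s hs => commutatorElement_mem_comm.mp
        (mem_centralizerMod_singleton.mp (hcent hs))) hc'
  exact Subgroup.commutator_le.mpr fun a ha b hb => mem_centralizerMod.mp (hall hb) a ha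

end LowerCentralSeries

namespace Representation

/-! ### Irreducibility and change of space -/

section Irreducible

variable {k G V W : Type*} [Field k] [Group G] [AddCommGroup V] [Module k V] [AddCommGroup W]
  [Module k W]

theorem isIrreducible_of_forall_mem [Nontrivial V] (ρ : Representation k G V)
    (h : ∀ U : Submodule k V, (∀ g, ∀ v ∈ U, ρ g v ∈ U) → ∀ v ∈ U, v ≠ 0 → ∀ w, w ∈ U) :
    ρ.IsIrreducible where
  exists_pair_ne := by
    obtain ⟨v, hv⟩ := exists_ne (0 : V)
    refine ⟨⊥, ⊤, fun hbt => hv ?_⟩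
    have : v ∈ (⊤ : Subrepresentation ρ) := Submodule.mem_top
    rw [← hbt] at this
    exact (Submodule.mem_bot k).mp this
  eq_bot_or_eq_top U := by
    by_cases hU : U.toSubmodule = ⊥
    · exact Or.inl (Subrepresentation.toSubmodule_injective hU)
    · obtain ⟨v, hvU, hv⟩ := Submodule.exists_mem_ne_zero_of_ne_bot hU
      refine Or.inr (Subrepresentation.toSubmodule_injective ((Submodule.eq_top_iff'.mpr ?_)))
      exact h _ (fun g v hv => U.apply_mem_toSubmodule g hv) v hvU hv

/-- The representation obtained from `ρ` by transport along a linear equivalence. -/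
def transport (ρ : Representation k G V) (e : V ≃ₗ[k] W) : Representation k G W where
  toFun g := e.conj (ρ g)
  map_one' := by ext; simp
  map_mul' g h := by ext; simp

/-- Needed because `IsIrreducibleCharacter` asks for the space `Fin n → ℂ`. -/
theorem IsIrreducible.transport {ρ : Representation k G V} (hρ : ρ.IsIrreducible)
    (e : V ≃ₗ[k] W) : (ρ.transport e).IsIrreducible := by
  obtain ⟨U₁, U₂, hU⟩ := hρ.exists_pair_ne
  have : Nontrivial V := by
    by_contra hV
    rw [not_nontrivial_iff_subsingleton] at hV
    exact hU (Subrepresentation.toSubmodule_injective (Subsingleton.elim _ _))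
  have : Nontrivial W := e.symm.toEquiv.nontrivial
  refine isIrreducible_of_forall_mem _ fun U hinv v hv hv0 w => ?_
  let U' : Subrepresentation ρ := ⟨U.comap e.toLinearMap, fun g v hv => by
    have := hinv g (e v) hv
    simpa [Representation.transport, LinearEquiv.conj_apply] using this⟩
  have hvU' : e.symm v ∈ U'.toSubmodule := by simpa [U'] using hv
  rcases hρ.eq_bot_or_eq_top U' with h | h
  · rw [h] at hvU'
    exact absurd ((Submodule.mem_bot k).mp hvU') (by simpa using hv0)
  · have hw : e.symm w ∈ U'.toSubmodule := by rw [h]; exact Submodule.mem_top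
    simpa [U'] using hw

end Irreducible

/-! ### Coinduction of a linear character -/

section LinearCharacter

variable {A : Type*} [Group A]

/-- The one-dimensional representation given by a linear character. -/
def ofLinearCharacter (μ : A →* ℂˣ) : Representation ℂ A ℂ where
  toFun a := (μ a : ℂ) • LinearMap.id
  map_one' := by ext; simp
  map_mul' a b := by ext; simp [mul_comm]

@[simp]
theorem ofLinearCharacter_apply (μ : A →* ℂˣ) (a : A) (z : ℂ) :
    ofLinearCharacter μ a z = μ a * z := rfl

variable {G : Type*} [Group G] (N : Subgroup G) (μ : N →* ℂˣ)

local notation "W" => coindV (Subgroup.subtype N) (ofLinearCharacter μ)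

theorem coindV_ofLinearCharacter_apply (f : W) (a : N) (g : G) :
    f.1 (a * g) = μ a * f.1 g := f.2 a g

open Classical in
/-- The function in the coinduced representation that extends `μ` by zero. -/
noncomputable def coindSingle : W where
  val g := if h : g ∈ N then (μ ⟨g, h⟩ : ℂ) else 0
  property a g := by
    by_cases hg : g ∈ N
    · have : (a : G) * g ∈ N := mul_mem a.2 hg
      dsimp only
      rw [Subgroup.subtype_apply, dif_pos this, dif_pos hg, ofLinearCharacter_apply,
        ← Units.val_mul, ← map_mul]
      rfl
    · have : (a : G) * g ∉ N := by rwa [Subgroup.mul_mem_cancel_left N a.2]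
      simp [hg, this]

theorem coindSingle_of_mem {g : G} (hg : g ∈ N) : (coindSingle N μ).1 g = μ ⟨g, hg⟩ :=
  dif_pos hg

theorem coindSingle_of_notMem {g : G} (hg : g ∉ N) : (coindSingle N μ).1 g = 0 :=
  dif_neg hg

theorem coind_apply_apply (g h : G) (f : W) :
    (coind N.subtype (ofLinearCharacter μ) g f).1 h = f.1 (h * g) := rfl

/-- The translates of `coindSingle` span the coinduced representation. -/
theorem mem_of_coindSingle_mem [Finite G] (U : Submodule ℂ W)
    (hU : ∀ g, ∀ f ∈ U, coind N.subtype (ofLinearCharacter μ) g f ∈ U)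
    (h : coindSingle N μ ∈ U) (f : W) : f ∈ U := by
  classical
  have := Fintype.ofFinite G
  -- This is `|N|`, written as a sum over `G` so that the substitution `g ↦ x * g⁻¹` matches the two
  -- sides of `hsum` term by term.
  set n : ℂ := ∑ g : G, if g ∈ N then 1 else 0 with hn
  have hn0 : n ≠ 0 := by
    rw [hn, Finset.sum_boole, Nat.cast_ne_zero, Finset.card_ne_zero]
    exact ⟨1, by simp [one_mem]⟩
  have hsum : n • f = ∑ g : G, f.1 g • coind N.subtype (ofLinearCharacter μ) g⁻¹
      (coindSingle N μ) := by
    ext x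
    simp only [Submodule.coe_smul, Submodule.coe_sum, Pi.smul_apply, Finset.sum_apply,
      coind_apply_apply, smul_eq_mul]
    rw [hn, ← ((Equiv.inv G).trans (Equiv.mulLeft x)).sum_comp, Finset.sum_mul]
    refine Finset.sum_congr rfl fun g _ => ?_
    change (if x * g⁻¹ ∈ N then (1 : ℂ) else 0) * _ = _
    by_cases hg : x * g⁻¹ ∈ N
    · have := coindV_ofLinearCharacter_apply N μ f ⟨_, hg⟩ g
      rw [coindSingle_of_mem N μ hg, if_pos hg, mul_comm (f.1 g), ← this]
      simp
    · rw [coindSingle_of_notMem N μ hg, if_neg hg]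
      simp
  have hmem : n • f ∈ U := hsum ▸ U.sum_mem fun g _ => U.smul_mem _ (hU _ _ h)
  exact (U.smul_mem_iff hn0).mp hmem

variable [N.Normal]

theorem map_conjNormal_mem (g a : N) : μ (MulAut.conjNormal (g : G) a) = μ a := by
  have : MulAut.conjNormal (g : G) a = g * a * g⁻¹ := by ext; simp
  rw [this]
  simp

/-- A linear character of a normal subgroup `N` whose stabilizer is `N` coinduces to an irreducible
representation. -/
theorem coind_isIrreducible [Finite G]
    (hμ : ∀ g ∉ N, ∃ a, μ (MulAut.conjNormal g a) ≠ μ a) :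
    (coind N.subtype (ofLinearCharacter μ)).IsIrreducible := by
  classical
  have := Fintype.ofFinite N
  have hsingle : coindSingle N μ ≠ 0 := by
    intro h
    have h1 := coindSingle_of_mem N μ (one_mem N)
    rw [h] at h1
    exact (μ ⟨1, one_mem N⟩).ne_zero h1.symm
  have : Nontrivial W := ⟨_, _, hsingle⟩
  refine isIrreducible_of_forall_mem _ fun U hU f hf hf0 => mem_of_coindSingle_mem N μ U hU ?_
  obtain ⟨x, hx⟩ : ∃ x, f.1 x ≠ 0 := by
    by_contra! h
    exact hf0 (Subtype.ext (funext h))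
  set f' := coind N.subtype (ofLinearCharacter μ) x f with hf'
  have hf'U : f' ∈ U := hU x f hf
  have hf'1 : f'.1 1 ≠ 0 := by
    rw [hf', coind_apply_apply, one_mul]
    exact hx
  -- Averaging against `μ⁻¹` over `N` projects onto functions supported on `N`: at `g ∉ N` the sum
  -- of the nontrivial character `μ^g / μ` vanishes.
  have hsum : ((Fintype.card N : ℂ) * f'.1 1) • coindSingle N μ =
      ∑ a : N, ((μ a)⁻¹ : ℂˣ).1 • coind N.subtype (ofLinearCharacter μ) a f' := by
    ext g
    simp only [Submodule.coe_smul, Submodule.coe_sum, Pi.smul_apply, Finset.sum_apply,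
      coind_apply_apply, smul_eq_mul]
    have hterm : ∀ a : N, ((μ a)⁻¹ : ℂˣ).1 * f'.1 (g * a) =
        ((μ.comp (MulAut.conjNormal g).toMonoidHom / μ : N →* ℂˣ) a : ℂ) * f'.1 g := by
      intro a
      have h1 := coindV_ofLinearCharacter_apply N μ f' (MulAut.conjNormal g a) g
      rw [MulAut.conjNormal_apply, inv_mul_cancel_right] at h1
      rw [h1, MonoidHom.div_apply, ← mul_assoc, ← Units.val_mul, div_eq_inv_mul]
      rfl
    rw [Finset.sum_congr rfl fun a _ => hterm a, ← Finset.sum_mul]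
    by_cases hg : g ∈ N
    · have h1 := coindV_ofLinearCharacter_apply N μ f' ⟨g, hg⟩ 1
      rw [mul_one] at h1
      have h2 : ∀ a, (μ.comp (MulAut.conjNormal g).toMonoidHom / μ : N →* ℂˣ) a = 1 := by
        intro a
        rw [MonoidHom.div_apply, div_eq_one]
        exact map_conjNormal_mem N μ ⟨g, hg⟩ a
      simp only [h2, coindSingle_of_mem N μ hg, Units.val_one, Finset.sum_const,
        Finset.card_univ, nsmul_eq_mul, mul_one, h1]
      ring
    · obtain ⟨b, hb⟩ := hμ g hg
      have h0 := sum_hom_units_eq_zero ((Units.coeHom ℂ).comp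
        (μ.comp (MulAut.conjNormal g).toMonoidHom / μ : N →* ℂˣ)) fun h => hb (by
          have := DFunLike.congr_fun h b
          exact div_eq_one.mp (Units.val_eq_one.mp this))
      rw [coindSingle_of_notMem N μ hg, mul_zero]
      have h0' : ∑ a : N, ((μ.comp (MulAut.conjNormal g).toMonoidHom / μ : N →* ℂˣ) a : ℂ) = 0 :=
        h0
      rw [h0', zero_mul]
  have hmem : ((Fintype.card N : ℂ) * f'.1 1) • coindSingle N μ ∈ U :=
    hsum ▸ U.sum_mem fun a _ => U.smul_mem _ (hU _ _ hf'U)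
  exact (U.smul_mem_iff (mul_ne_zero (Nat.cast_ne_zero.mpr Fintype.card_ne_zero) hf'1)).mp hmem

theorem mul_out_inv_mem (g : G) : g * ((g : G ⧸ N).out)⁻¹ ∈ N := by
  obtain ⟨a, ha⟩ := QuotientGroup.mk_out_eq_mul N g
  rw [ha, mul_inv_rev, ← mul_assoc]
  exact ‹N.Normal›.conj_mem _ (inv_mem a.2) g

/-- The space of the representation coinduced from a linear character of `N` is isomorphic to the
space of functions on `G ⧸ N`. -/
noncomputable def coindVEquivQuotient : W ≃ₗ[ℂ] (G ⧸ N → ℂ) where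
  toFun f q := f.1 q.out
  map_add' _ _ := rfl
  map_smul' _ _ := rfl
  invFun φ := ⟨fun g => μ ⟨_, mul_out_inv_mem N g⟩ * φ g, fun a g => by
    have hq : ((a * g : G) : G ⧸ N) = g := by
      rw [QuotientGroup.eq, mul_inv_rev]
      simpa using ‹N.Normal›.conj_mem _ (inv_mem a.2) g⁻¹
    have ha : (⟨_, mul_out_inv_mem N (a * g)⟩ : N) = a * ⟨_, mul_out_inv_mem N g⟩ := by
      ext
      simp only [hq, Subgroup.coe_mul, mul_assoc]
    simp only [Subgroup.subtype_apply, ofLinearCharacter_apply]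
    rw [ha, hq, map_mul, Units.val_mul, mul_assoc]⟩
  left_inv f := by
    ext g
    have := coindV_ofLinearCharacter_apply N μ f ⟨_, mul_out_inv_mem N g⟩ (g : G ⧸ N).out
    rw [inv_mul_cancel_right] at this
    exact this.symm
  right_inv φ := by
    ext q
    have h : (⟨_, mul_out_inv_mem N q.out⟩ : N) = 1 := by
      ext
      simp
    dsimp only
    rw [h, map_one, Units.val_one, one_mul, QuotientGroup.out_eq']

/-- A linear character of a normal subgroup `N` whose stabilizer is `N` gives rise to an irreducible
character of degree `|G : N|`. -/
theorem exists_isIrreducibleCharacter_of_stabilizer [Finite G]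
    (hμ : ∀ g ∉ N, ∃ a, μ (MulAut.conjNormal g a) ≠ μ a) :
    ∃ χ : G → ℂ, IsIrreducibleCharacter χ ∧ χ 1 = N.index := by
  let e : W ≃ₗ[ℂ] (Fin N.index → ℂ) := (coindVEquivQuotient N μ).trans
    (LinearEquiv.funCongrLeft ℂ ℂ (Finite.equivFin (G ⧸ N)).symm)
  refine ⟨_, ⟨_, _, (coind_isIrreducible N μ hμ).transport e, rfl⟩, ?_⟩
  simp

end LinearCharacter

end Representation
-- Linear characters, their kernels and stabilizers
section LinearCharacters

/-- Linear characters trivial on `N ≥ A'` separate the elements outside `N` from `1`. -/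
theorem exists_linearCharacter_apply_ne_one {A : Type*} [Group A] [Finite A] (N : Subgroup A)
    [N.Normal] (hN : ⁅(⊤ : Subgroup A), (⊤ : Subgroup A)⁆ ≤ N) {x : A} (hx : x ∉ N) :
    ∃ μ : A →* ℂˣ, (∀ n ∈ N, μ n = 1) ∧ μ x ≠ 1 := by
  let _ : CommGroup (A ⧸ N) :=
    { (inferInstance : Group (A ⧸ N)) with
      mul_comm := by
        intro a b
        obtain ⟨a, rfl⟩ := QuotientGroup.mk'_surjective N a
        obtain ⟨b, rfl⟩ := QuotientGroup.mk'_surjective N b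
        rw [← commutatorElement_eq_one_iff_mul_comm, ← map_commutatorElement]
        exact (QuotientGroup.eq_one_iff (N := N) _).mpr
          (hN (Subgroup.commutator_mem_commutator trivial trivial)) }
  obtain ⟨φ, hφ⟩ := CommGroup.exists_apply_ne_one_of_hasEnoughRootsOfUnity (A ⧸ N) ℂ
    (a := (x : A ⧸ N)) (by rwa [Ne, QuotientGroup.eq_one_iff])
  refine ⟨φ.comp (QuotientGroup.mk' N), fun n hn => ?_, hφ⟩
  rw [MonoidHom.comp_apply, QuotientGroup.mk'_apply, (QuotientGroup.eq_one_iff n).mpr hn, map_one]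

variable {G : Type*} [Group G]

theorem exists_linearCharacter_subgroup_apply_ne_one [Finite G] {A N : Subgroup G} [N.Normal]
    (hN : ⁅A, A⁆ ≤ N) {x : G} (hxA : x ∈ A) (hx : x ∉ N) :
    ∃ μ : A →* ℂˣ, (∀ n : A, (n : G) ∈ N → μ n = 1) ∧ μ ⟨x, hxA⟩ ≠ 1 :=
  exists_linearCharacter_apply_ne_one (N.subgroupOf A)
    (Subgroup.commutator_le.mpr fun a _ b _ =>
      hN (Subgroup.commutator_mem_commutator a.2 b.2)) (x := ⟨x, hxA⟩) hx

variable {A : Subgroup G}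

/-- The kernel of a linear character of a subgroup, as a subgroup of the whole group. -/
def linearCharacterKer (μ : A →* ℂˣ) : Subgroup G := μ.ker.map A.subtype

theorem mem_linearCharacterKer {μ : A →* ℂˣ} {x : G} (hx : x ∈ A) :
    x ∈ linearCharacterKer μ ↔ μ ⟨x, hx⟩ = 1 := by
  constructor
  · rintro ⟨y, hy, rfl⟩
    exact hy
  · exact fun h => ⟨⟨x, hx⟩, h, rfl⟩

variable [A.Normal]

/-- The stabilizer in `G` of a linear character of a normal subgroup. -/
def linearCharacterStabilizer (μ : A →* ℂˣ) : Subgroup G where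
  carrier := {g | ∀ a, μ (MulAut.conjNormal g a) = μ a}
  one_mem' a := by simp
  mul_mem' {g h} hg hh a := by rw [map_mul, MulAut.mul_apply, hg, hh]
  inv_mem' {g} hg a := by
    rw [← hg, ← MulAut.mul_apply, ← map_mul]
    simp

theorem le_linearCharacterStabilizer (μ : A →* ℂˣ) : A ≤ linearCharacterStabilizer μ :=
  fun g hg a => Representation.map_conjNormal_mem A μ ⟨g, hg⟩ a

theorem commutator_mem_linearCharacterKer {μ : A →* ℂˣ} {a g : G} (ha : a ∈ A)
    (hg : g ∈ linearCharacterStabilizer μ) : ⁅a, g⁆ ∈ linearCharacterKer μ := by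
  refine ⟨⟨a, ha⟩ * MulAut.conjNormal g ⟨a, ha⟩⁻¹, ?_, ?_⟩
  · rw [SetLike.mem_coe, MonoidHom.mem_ker, map_mul, hg, ← map_mul, mul_inv_cancel, map_one]
  · simp [commutatorElement_def, mul_assoc]

end LinearCharacters

/-! ### A linear character of `γ₂` with stabilizer `γ₂` -/

section LowerCentralSeries

variable {G : Type*} [Group G]

local notation "Γ" => Subgroup.lowerCentralSeries (⊤ : Subgroup G)

/-- The part in `γ₄` of the kernel of a linear character of `γ₂` that is trivial on `γ₅` is
normal. -/
theorem linearCharacterKer_inf_normal {μ : Γ 1 →* ℂˣ}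
    (hμ : ∀ n : Γ 1, (n : G) ∈ Γ 4 → μ n = 1) : (linearCharacterKer μ ⊓ Γ 3).Normal := by
  have h41 : Γ 4 ≤ Γ 1 := Subgroup.lowerCentralSeries_antitone _ (by norm_num)
  refine normal_of_le_of_commutator_le (N := Γ 4) (H := Γ 3) le_rfl (fun x hx => ⟨?_, ?_⟩)
    inf_le_right
  · exact (mem_linearCharacterKer (h41 hx)).mpr (hμ _ hx)
  · exact lowerCentralSeries_succ_le 3 hx

/-- If `μ` and `ν` agree on `γ₄`, then modulo the kernel of `ν` on `γ₄` the commutators of `γ₂`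
with the stabilizer of `μ` are central. -/
theorem linearCharacterStabilizer_le {μ ν : Γ 1 →* ℂˣ}
    [(linearCharacterKer ν ⊓ Γ 3).Normal] (hμν : ∀ n : Γ 1, (n : G) ∈ Γ 3 → μ n = ν n) :
    linearCharacterStabilizer μ ≤
      centralizerMod (centralizerMod (linearCharacterKer ν ⊓ Γ 3) Set.univ) (Γ 1 : Set G) := by
  have h31 : Γ 3 ≤ Γ 1 := Subgroup.lowerCentralSeries_antitone _ (by norm_num)
  have hnormal : (linearCharacterStabilizer μ).Normal :=
    Subgroup.Normal.of_commutator_le G (le_linearCharacterStabilizer μ)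
  intro g hg
  refine mem_centralizerMod.mpr fun a ha => mem_centralizerMod_univ.mpr fun h => ?_
  have h3 : ⁅⁅a, g⁆, h⁆ ∈ Γ 3 :=
    commutator_mem_lowerCentralSeries_succ (commutator_mem_lowerCentralSeries_succ ha g) h
  refine Subgroup.mem_inf.mpr ⟨?_, h3⟩
  -- On `γ₄` the kernels of `μ` and `ν` agree. Up to inversion, the element is `[hah⁻¹, hgh⁻¹] [a,
  -- g]⁻¹`, and both factors lie in the kernel of `μ` because the stabilizer is normal.
  rw [mem_linearCharacterKer (h31 h3), ← hμν _ h3, ← mem_linearCharacterKer (h31 h3),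
    commutatorElement_mem_comm, commutatorElement_def]
  refine mul_mem ?_ (inv_mem (commutator_mem_linearCharacterKer ha hg))
  rw [conjugate_commutatorElement]
  exact commutator_mem_linearCharacterKer
    (Subgroup.Normal.conj_mem inferInstance a ha h) (hnormal.conj_mem g hg h)

/-- If `γ₂` has index `p ^ 2` and is abelian modulo `γ₅ < γ₄`, and if some `c ∈ γ₂` is not
centralized modulo `γ₄` by any element outside `γ₂`, then some linear character of `γ₂` has
stabilizer `γ₂`. -/
theorem exists_linearCharacterStabilizer_le [Finite G] {p : ℕ} (hp : p.Prime)
    (hindex : (Γ 1).index = p ^ 2) (hcomm : ⁅Γ 1, Γ 1⁆ ≤ Γ 4) (hlt : ¬ Γ 3 ≤ Γ 4) {c : G}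
    (hc : c ∈ Γ 1) (hcent : ∀ m ∉ Γ 1, ⁅c, m⁆ ∉ Γ 3) :
    ∃ μ : Γ 1 →* ℂˣ, linearCharacterStabilizer μ ≤ Γ 1 := by
  have h31 : Γ 3 ≤ Γ 1 := Subgroup.lowerCentralSeries_antitone _ (by norm_num)
  obtain ⟨z, hz, hz'⟩ := SetLike.not_le_iff_exists.mp hlt
  obtain ⟨ν, hν, hνz⟩ := exists_linearCharacter_subgroup_apply_ne_one hcomm (h31 hz) hz'
  by_cases hstab : linearCharacterStabilizer ν ≤ Γ 1
  · exact ⟨ν, hstab⟩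
  obtain ⟨m, hm, hm'⟩ := SetLike.not_le_iff_exists.mp hstab
  have hd : ⁅c, m⁆ ∈ Γ 1 :=
    lowerCentralSeries_succ_le 1 (commutator_mem_lowerCentralSeries_succ hc m)
  obtain ⟨θ, hθ, hθd⟩ := exists_linearCharacter_subgroup_apply_ne_one
    (hcomm.trans (lowerCentralSeries_succ_le 3)) hd (hcent m hm')
  refine ⟨ν * θ, ?_⟩
  by_contra hstab'
  obtain ⟨l, hl, hl'⟩ := SetLike.not_le_iff_exists.mp hstab'
  have hmT : m ∉ linearCharacterStabilizer (ν * θ) := by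
    intro h
    have hmθ : m ∈ linearCharacterStabilizer θ := by
      intro a
      have := h a
      rwa [MonoidHom.mul_apply, MonoidHom.mul_apply, hm a, mul_right_inj] at this
    exact hθd ((mem_linearCharacterKer hd).mp (commutator_mem_linearCharacterKer hc hmθ))
  have := linearCharacterKer_inf_normal hν
  have hU₁ := linearCharacterStabilizer_le (μ := ν) (ν := ν) fun _ _ => rfl
  have hU₂ := linearCharacterStabilizer_le (μ := ν * θ) (ν := ν) fun n hn => by
    rw [MonoidHom.mul_apply, hθ n hn, mul_one]
  -- This subgroup contains both stabilizers. That of `ν * θ` has index `p` and misses `m`, which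
  -- stabilizes `ν`. Equality with `G` then forces `γ₄` into the kernel of `ν`.
  have htop : centralizerMod (centralizerMod (linearCharacterKer ν ⊓ Γ 3) Set.univ)
      (Γ 1 : Set G) = ⊤ := by
    rcases eq_top_or_index_eq_of_index_sq hp hindex (le_linearCharacterStabilizer (ν * θ)) hl hl'
      with h | h
    · exact absurd (h.ge (Subgroup.mem_top m)) hmT
    · exact eq_top_of_index_prime (h ▸ hp) hU₂ (hU₁ hm) hmT
  have h2 : Γ 2 ≤ centralizerMod (linearCharacterKer ν ⊓ Γ 3) Set.univ :=
    Subgroup.commutator_le.mpr fun a ha g _ =>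
      mem_centralizerMod.mp (htop.ge (Subgroup.mem_top g)) a ha
  have h3 : Γ 3 ≤ linearCharacterKer ν ⊓ Γ 3 :=
    Subgroup.commutator_le.mpr fun a ha g _ => mem_centralizerMod_univ.mp (h2 ha) g
  exact hνz ((mem_linearCharacterKer (h31 hz)).mp (h3 hz).1)

end LowerCentralSeries

theorem theorem3 {G : Type*} [Group G] [Finite G] (p : ℕ) (hp : p.Prime) (hG : IsPGroup p G)
    (hG' : (commutator G).index = p ^ 2) (hcard : p ^ 6 ≤ Nat.card G) :
    (p < (lowerCentralTerm G 4).relIndex (lowerCentralTerm G 3) ↔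
      (lowerCentralTerm G 4).index = p ^ 5) ∧
    (p < (lowerCentralTerm G 4).relIndex (lowerCentralTerm G 3) →
      ∃ χ : G → ℂ, IsIrreducibleCharacter χ ∧ χ 1 = (p : ℂ) ^ 2) := by
  have : Fact p.Prime := ⟨hp⟩
  have : Group.IsNilpotent G := hG.isNilpotent
  set Γ := Subgroup.lowerCentralSeries (⊤ : Subgroup G)
  have hindex : (Γ 1).index = p ^ 2 := hG'
  change (p < (Γ 3).relIndex (Γ 2) ↔ (Γ 3).index = p ^ 5) ∧ (p < (Γ 3).relIndex (Γ 2) → _)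
  -- The bound `|G| ≥ p⁶` enters only here; it makes `γ₂` and, later, `γ₄` nontrivial.
  have hbot : ∀ H : Subgroup G, H.index ∣ p ^ 5 → H ≠ ⊥ := by
    rintro H hH rfl
    rw [Subgroup.index_bot] at hH
    have h1 := Nat.le_of_dvd (pow_pos hp.pos 5) hH
    have h2 := Nat.pow_lt_pow_right hp.one_lt (show 5 < 6 by norm_num)
    omega
  have hrel : (Γ 2).relIndex (Γ 1) = p := relIndex_lowerCentralSeries_one hp hindex
    (hbot _ (hindex ▸ pow_dvd_pow p (by norm_num)))
  have hrelp : ((Γ 2).relIndex (Γ 1)).Prime := hrel.symm ▸ hp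
  obtain ⟨c, hc, hc'⟩ : ∃ c ∈ Γ 1, c ∉ Γ 2 := by
    by_contra! h
    exact hrelp.ne_one (Subgroup.relIndex_eq_one.mpr h)
  have hrel' := relIndex_lowerCentralSeries_two hrelp hc hc'
  have hle : Γ 1 ≤ centralizerMod (Γ 3) {c} := fun a ha =>
    mem_centralizerMod_singleton.mpr (lowerCentralSeries_succ_le 3
      (commutator_lowerCentralSeries_one_one_le hrelp
        (Subgroup.commutator_mem_commutator hc ha)))
  have hindex3 : (Γ 3).index = (Γ 3).relIndex (Γ 2) * p ^ 3 := by
    rw [← Subgroup.relIndex_mul_index (lowerCentralSeries_succ_le 2),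
      ← Subgroup.relIndex_mul_index (lowerCentralSeries_succ_le 1), hrel, hindex]
    ring
  have hsq : p < (Γ 3).relIndex (Γ 2) → (Γ 3).relIndex (Γ 2) = p ^ 2 := by
    intro hlt
    have hdvd : (Γ 3).relIndex (Γ 2) ∣ p ^ 2 := by
      rw [hrel', ← hindex]
      exact Subgroup.index_dvd_of_le hle
    obtain ⟨k, hk, hkp⟩ := (Nat.dvd_prime_pow hp).mp hdvd
    have hk1 : 1 < k := by
      rw [hkp] at hlt
      by_contra! hk1
      exact absurd (Nat.pow_le_pow_right hp.pos hk1) (by simpa using hlt)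
    rw [hkp, show k = 2 by omega]
  refine ⟨⟨fun h => ?_, fun h => ?_⟩, fun h => ?_⟩
  · rw [hindex3, hsq h]
    ring
  · rw [hindex3, show p ^ 5 = p ^ 2 * p ^ 3 by ring] at h
    rw [Nat.eq_of_mul_eq_mul_right (pow_pos hp.pos 3) h, sq]
    exact lt_mul_of_one_lt_left hp.pos hp.one_lt
  · have hcent : ∀ m ∉ Γ 1, ⁅c, m⁆ ∉ Γ 3 := by
      intro m hm hcm
      rcases eq_top_or_index_eq_of_index_sq hp hindex hle
        (mem_centralizerMod_singleton.mpr hcm) hm with h' | h'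
      · rw [hrel', h', Subgroup.index_top] at h
        exact absurd h hp.one_lt.not_gt
      · rw [hrel', h'] at h
        exact lt_irrefl _ h
    have hlt : ¬ Γ 3 ≤ Γ 4 := lowerCentralSeries_succ_lt
      (hbot _ (by rw [hindex3, hsq h]; exact ⟨1, by ring⟩))
    obtain ⟨μ, hμ⟩ := exists_linearCharacterStabilizer_le hp hindex
      (commutator_lowerCentralSeries_one_one_le hrelp) hlt hc hcent
    obtain ⟨χ, hχ, hχ1⟩ := Representation.exists_isIrreducibleCharacter_of_stabilizer (Γ 1) μ
      fun g hg => by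
        by_contra! hstab
        exact hg (hμ hstab)
    exact ⟨χ, hχ, by rw [hχ1, hindex, Nat.cast_pow]⟩
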